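/- **Definitions.** The brickwall $\mathcal{B}$ is the infinite 3-regular plane graph in which every face has length 6, drawn with vertices $b_{i,j}$ $(i,j\in\mathbb{Z})$, where $b_{i,j}$ is placed at the point $(i-j,\,j)$ of the plane, with horizontal edges $b_{i,j}b_{i+1,j}$ and vertical edges $b_{i,j}b_{i+1,j+1}$ for $i$ odd. A closed walk $W=v_0,\dots,v_k$ in $\mathcal{B}$ (so $v_k=v_0$) of length $k$ is assumed not to turn back: writing $W_x=v_{x \bmod k}$, we have $W_{i-1}\neq W_{i+1}$ for all $i$. $W$ makes a right (left) turn at $i$ if the edge $W_iW_{i-1}$ immediately follows the edge $W_iW_{i+1}$ in the clockwise (anticlockwise) order around $W_i$. Let $\mathrm{Right}(W)$ and $\mathrm{Left}(W)$ be the numbers of indices $i\in\{0,\dots,k-1\}$ at which $W$ makes a right, respectively left, turn, and let $t(W)=(\mathrm{Right}(W)-\mathrm{Left}(W))/6$ be the turning number of $W$. A hexagonal patch is a finite 2-connected plane graph (considered as a combinatorial embedding in the sphere with one face chosen as the outer face) in which all inner faces have length 6, all vertices on the boundary of the outer face have degree 2 or 3, and all other vertices have degree 3. A locally injective homomorphism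 from a hexagonal patch $H$ to $\mathcal{B}$ is a map $\phi:V(H)\to V(\mathcal{B})$ that maps adjacent vertices to adjacent vertices and maps the neighbours of any vertex of $H$ to pairwise different vertices. A solution for a closed walk $W$ of length $k$ in $\mathcal{B}$ is a triple $(H,\phi,B)$ where $H$ is a hexagonal patch, $\phi$ is a locally injective homomorphism from $H$ to $\mathcal{B}$, and $B$ is a boundary cycle of $H$ of length $k$ (starting at any boundary vertex, in either direction), such that $\phi(B_i)=W_i$ for all $i$. The solution is clockwise if for every $i$ the degree in $H$ of $B_i$ is 2 if $W$ makes a right turn at $i$, and 3 if $W$ makes a left turn at $i$; it is anticlockwise if for every $i$ this degree is 3 if $W$ makes a right turn at $i$, and 2 if $W$ makes a left turn at $i$. **Lemma.** Let $W$ be a closed walk in $\mathcal{B}$. If $t(W)=1$, then every solution for $W$ is clockwise. If $t(W)=-1$, then every solution for $W$ is anticlockwise. If $t(W)\notin\{-1,1\}$, then no solution for $W$ exists. -/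

import Mathlib

universe u

/-! ### Walks that do not turn back, and cyclic indexing of closed walks -/

/-- The vertex `W_x` of a closed walk `W = v_0, …, v_k`, the index `x` being read modulo `k`. -/
def SimpleGraph.Walk.cycVert {V : Type*} {G : SimpleGraph V} {w : V} (W : G.Walk w w) (x : ℤ) : V :=
  W.getVert (x % (W.length : ℤ)).toNat

/-- A closed walk does not turn back: `W_{i-1} ≠ W_{i+1}` for every index `i`, cyclically. -/
def SimpleGraph.Walk.NoTurnBack {V : Type*} {G : SimpleGraph V} {w : V} (W : G.Walk w w) : Prop :=
  ∀ i : ℕ, i < W.length → W.cycVert ((i : ℤ) - 1) ≠ W.cycVert ((i : ℤ) + 1)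

/-! ### The brickwall -/

/-- The three neighbours, in clockwise order, of the vertex `b_{i,j}` of the brickwall.
In the drawing `b_{i,j}` is the point `(i - j, j)` of the plane (first coordinate to the right,
second coordinate upwards): for odd `i` there is a neighbour `b_{i+1,j+1}` straight above
(clockwise order: up, right, left), for even `i` there is a neighbour `b_{i-1,j-1}` straight below
(clockwise order: down, left, right). The indices `0, 1, 2` are read cyclically. -/
def brickNbr (v : ℤ × ℤ) : Fin 3 → ℤ × ℤ :=
  if Odd v.1 then ![(v.1 + 1, v.2 + 1), (v.1 + 1, v.2), (v.1 - 1, v.2)]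
  else ![(v.1 - 1, v.2 - 1), (v.1 - 1, v.2), (v.1 + 1, v.2)]

/-- `b_{i,j} b_{i+1,j}` (a horizontal edge, any `i`) or `b_{i,j} b_{i+1,j+1}` (a vertical edge,
`i` odd), the edge being directed upwards in `i`. -/
def brickStep (v w : ℤ × ℤ) : Prop :=
  w = (v.1 + 1, v.2) ∨ (Odd v.1 ∧ w = (v.1 + 1, v.2 + 1))

/-- The brickwall: the infinite 3-regular plane graph all of whose faces have length 6. -/
def brickwall : SimpleGraph (ℤ × ℤ) where
  Adj v w := brickStep v w ∨ brickStep w v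
  symm := ⟨fun _ _ h => h.symm⟩
  loopless := ⟨by
    rintro ⟨i, j⟩ h
    simp [brickStep] at h⟩

/-- The neighbours of a vertex of the brickwall are the three listed ones. -/
theorem brickwall_adj_iff (v w : ℤ × ℤ) : brickwall.Adj v w ↔ ∃ c, w = brickNbr v c := by
  obtain ⟨i, j⟩ := v
  obtain ⟨a, b⟩ := w
  by_cases hi : Odd i <;>
    simp [brickwall, brickStep, brickNbr, hi, Fin.exists_fin_succ] <;> grind

/-- The three listed neighbours are distinct. -/
theorem brickNbr_injective (v : ℤ × ℤ) : Function.Injective (brickNbr v) := by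
  obtain ⟨i, j⟩ := v
  intro a b
  by_cases hi : Odd i <;> fin_cases a <;> fin_cases b <;> simp [brickNbr, hi] <;> grind

/-- `W` makes a right turn at `i`: the edge `W_i W_{i-1}` immediately follows the edge
`W_i W_{i+1}` in the clockwise order around `W_i`. -/
def RightTurn {w : ℤ × ℤ} (W : brickwall.Walk w w) (i : ℤ) : Prop :=
  ∃ c : Fin 3, W.cycVert (i + 1) = brickNbr (W.cycVert i) c ∧
    W.cycVert (i - 1) = brickNbr (W.cycVert i) (c + 1)

/-- `W` makes a left turn at `i`: the edge `W_i W_{i-1}` immediately follows the edge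
`W_i W_{i+1}` in the anticlockwise order around `W_i`. -/
def LeftTurn {w : ℤ × ℤ} (W : brickwall.Walk w w) (i : ℤ) : Prop :=
  ∃ c : Fin 3, W.cycVert (i + 1) = brickNbr (W.cycVert i) c ∧
    W.cycVert (i - 1) = brickNbr (W.cycVert i) (c - 1)

open Classical in
/-- The number of indices at which `W` makes a right turn. -/
noncomputable def rightCount {w : ℤ × ℤ} (W : brickwall.Walk w w) : ℕ :=
  ((Finset.range W.length).filter fun i => RightTurn W (i : ℤ)).card

open Classical in
/-- The number of indices at which `W` makes a left turn. -/
noncomputable def leftCount {w : ℤ × ℤ} (W : brickwall.Walk w w) : ℕ :=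
  ((Finset.range W.length).filter fun i => LeftTurn W (i : ℤ)).card

/-- The turning number `t(W) = (Right(W) - Left(W)) / 6`. -/
noncomputable def turningNumber {w : ℤ × ℤ} (W : brickwall.Walk w w) : ℚ :=
  ((rightCount W : ℚ) - (leftCount W : ℚ)) / 6

/-! ### Plane graphs, as combinatorial embeddings -/

/-- A combinatorial embedding of a graph in an oriented surface: a permutation of the darts
(directed edges) sending each dart to the next one in clockwise order around its initial vertex;
the darts leaving a given vertex form a single cycle of it. -/
structure RotationSystem {V : Type*} (G : SimpleGraph V) where
  rot : Equiv.Perm G.Dart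
  rot_fst : ∀ d, (rot d).fst = d.fst
  sameCycle : ∀ d d', d.fst = d'.fst → rot.SameCycle d d'

namespace RotationSystem

variable {V : Type*} {G : SimpleGraph V}

/-- The next dart along the face lying to the left of a dart `d = (x, y)`: the dart that follows
`(y, x)` in the clockwise order around `y`. -/
def faceNext (R : RotationSystem G) : Equiv.Perm G.Dart :=
  (SimpleGraph.Dart.symm_involutive.toPerm).trans R.rot

/-- The faces: the orbits of darts under `faceNext`. -/
def Face (R : RotationSystem G) : Type _ :=
  Quotient (Equiv.Perm.SameCycle.setoid R.faceNext)

/-- The face to the left of a dart. -/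
def faceOf (R : RotationSystem G) (d : G.Dart) : R.Face :=
  Quotient.mk (Equiv.Perm.SameCycle.setoid R.faceNext) d

/-- The length of a face: the number of darts of its facial walk. -/
noncomputable def faceLength (R : RotationSystem G) (f : R.Face) : ℕ :=
  Nat.card {d : G.Dart // R.faceOf d = f}

/-- The Euler characteristic `|V| - |E| + |F|` of the closed surface obtained by gluing a disc to
each facial walk (of a finite connected graph with at least one edge). -/
noncomputable def eulerChar (R : RotationSystem G) : ℤ :=
  (Nat.card V : ℤ) - (Nat.card G.edgeSet : ℤ) + (Nat.card R.Face : ℤ)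

/-- The surface of a combinatorial embedding is the sphere: its genus `(2 - χ) / 2` is zero. -/
def IsSpherical (R : RotationSystem G) : Prop := R.eulerChar = 2

end RotationSystem

/-- A finite connected plane graph (with at least one edge): a graph with a combinatorial embedding
in the sphere, and a choice of the face that is the outer (unbounded) one. -/
structure PlaneGraph where
  V : Type u
  finite : Finite V
  graph : SimpleGraph V
  connected : graph.Connected
  emb : RotationSystem graph
  spherical : emb.IsSpherical
  outer : emb.Face

namespace PlaneGraph

/-- An edge of the boundary: an edge incident with the outer face. -/
def IsBoundaryEdge (H : PlaneGraph.{u}) (e : Sym2 H.V) : Prop :=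
  ∃ d : H.graph.Dart, H.emb.faceOf d = H.outer ∧ d.edge = e

/-- A boundary vertex: a vertex incident with the outer face. -/
def IsBoundaryVertex (H : PlaneGraph.{u}) (v : H.V) : Prop :=
  ∃ d : H.graph.Dart, H.emb.faceOf d = H.outer ∧ d.fst = v

/-- The degree of a vertex. -/
noncomputable def deg (H : PlaneGraph.{u}) (v : H.V) : ℕ := (H.graph.neighborSet v).ncard

/-- A boundary cycle: a cycle of the graph running (once) through the edges of the boundary. -/
def IsBoundaryCycle (H : PlaneGraph.{u}) {b : H.V} (B : H.graph.Walk b b) : Prop :=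
  B.IsCycle ∧ ∀ e, e ∈ B.edges ↔ H.IsBoundaryEdge e

end PlaneGraph

/-- A graph is 2-connected: it has more than two vertices, it is connected, and it stays connected
when any one vertex is deleted. -/
def TwoConnected {V : Type*} (G : SimpleGraph V) : Prop :=
  2 < Nat.card V ∧ G.Connected ∧ ∀ v : V, (G.induce {v}ᶜ).Connected

/-- A hexagonal patch: a 2-connected plane graph in which all inner faces have length 6, boundary
vertices have degree 2 or 3, and all other vertices have degree 3. -/
structure HexPatch extends PlaneGraph.{u} where
  twoConnected : TwoConnected graph
  inner_length : ∀ f : emb.Face, f ≠ outer → emb.faceLength f = 6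
  deg_boundary : ∀ v, toPlaneGraph.IsBoundaryVertex v →
    toPlaneGraph.deg v = 2 ∨ toPlaneGraph.deg v = 3
  deg_interior : ∀ v, ¬ toPlaneGraph.IsBoundaryVertex v → toPlaneGraph.deg v = 3

/-! ### Solutions -/

/-- A solution `(H, φ, B)` of a closed walk `W` in the brickwall: a hexagonal patch `H`, a locally
injective homomorphism `φ` from `H` to the brickwall, and a boundary cycle `B` of `H` of the same
length as `W`, with `φ (B_i) = W_i` for all `i`. -/
structure Solution {w : ℤ × ℤ} (W : brickwall.Walk w w) where
  H : HexPatch.{u}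
  φ : H.graph →g brickwall
  locallyInjective : ∀ v, Set.InjOn φ (H.graph.neighborSet v)
  base : H.V
  B : H.graph.Walk base base
  isBoundaryCycle : H.IsBoundaryCycle B
  length_eq : B.length = W.length
  map_eq : ∀ i : ℤ, φ (B.cycVert i) = W.cycVert i

/-- A solution is clockwise: for every `i`, `B_i` has degree 2 if `W` makes a right turn at `i`,
and degree 3 if `W` makes a left turn at `i`. -/
def Solution.IsClockwise {w : ℤ × ℤ} {W : brickwall.Walk w w} (S : Solution.{u} W) : Prop :=
  ∀ i : ℤ, (RightTurn W i → S.H.deg (S.B.cycVert i) = 2) ∧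
    (LeftTurn W i → S.H.deg (S.B.cycVert i) = 3)

/-- A solution is anticlockwise: for every `i`, `B_i` has degree 3 if `W` makes a right turn at `i`,
and degree 2 if `W` makes a left turn at `i`. -/
def Solution.IsAnticlockwise {w : ℤ × ℤ} {W : brickwall.Walk w w} (S : Solution.{u} W) : Prop :=
  ∀ i : ℤ, (RightTurn W i → S.H.deg (S.B.cycVert i) = 3) ∧
    (LeftTurn W i → S.H.deg (S.B.cycVert i) = 2)

/-!
Let `(H, φ, B)` be a solution for `W`. The neighbours of a brickwall vertex are indexed by `Fin 3`
so that an edge gets the same index at both ends (`brickNbr_brickNbr`). The pulled-back index of a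
dart `d` of `H` is `dartColor φ d`, and the turn that `φ` of a facial walk makes after `d` is the
difference `faceTurn φ d` of two consecutive indices; it is `1` or `-1` in `Fin 3`.

*`φ` preserves or reverses orientation globally.* The boundary of an inner face is mapped to a
closed walk of length 6 that does not turn back. In the brickwall such a walk runs around a face, so
all its turns are the same (`brickNbr_hexagon`, `faceTurn_faceNext`). At a vertex of degree 3, local
injectivity makes the turns of all incident faces the same, and at a vertex of degree 2 there is
only one inner face (`faceTurn_eq_of_snd_eq`). Every edge lies on an inner face
(`not_isOuter_symm`), so the connectedness of `H` gives one turn `σ` common to all inner faces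
(`exists_faceTurn_eq`).

*The boundary.* The boundary cycle has the outer face on the same side all along
(`isOuter_cycDart_iff_zero`). Suppose that it has the inner faces on the side where their facial
walks run along with it. At a vertex of degree 2, `W` then turns as the image of the inner face at
that vertex does. At a vertex of degree 3, the third edge is where the inner face turns, and `W`
turns the opposite way. In the other direction all turns are reversed. Hence every solution is
clockwise or anticlockwise, and the turns of `W` determine the degrees and conversely
(`Solution.degree_iff_turn`).

*The count.* By Euler's formula the boundary has six more vertices of degree 2 than of degree 3
(`card_deg_two_eq_card_deg_three_add_six`). So `t(W) = 1` for a clockwise solution and `t(W) = -1`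
for an anticlockwise one (`Solution.turningNumber_eq`), which implies all three claims.
-/

/-! ### Orbits of permutations -/

open Function in
theorem Equiv.Perm.ncard_sameCycle {α : Type*} [Finite α] (f : Equiv.Perm α) (x : α) :
    {y | f.SameCycle x y}.ncard = minimalPeriod f x := by
  have hx : x ∈ periodicPts f := by
    have := f.injective.mem_periodicPts x
    exact this
  have h : {y | f.SameCycle x y} = (f^[·] x) '' Set.Iio (minimalPeriod f x) := by
    ext y
    constructor
    · intro h
      obtain ⟨n, hn⟩ := h.exists_nat_pow_eq
      refine ⟨n % minimalPeriod f x, Nat.mod_lt _ (minimalPeriod_pos_of_mem_periodicPts hx), ?_⟩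
      simp only [iterate_mod_minimalPeriod_eq]
      rw [← hn, Equiv.Perm.coe_pow]
    · rintro ⟨n, -, rfl⟩
      exact ⟨n, by rw [zpow_natCast, Equiv.Perm.coe_pow]⟩
  rw [h, iterate_injOn_Iio_minimalPeriod.ncard_image]
  simp

open Function in
/-- A point in the orbit of `x` is reached from `x` in fewer steps than the orbit has points. -/
theorem Equiv.Perm.SameCycle.exists_lt_iterate_eq {α : Type*} [Finite α] {f : Equiv.Perm α}
    {x y : α} (h : f.SameCycle x y) :
    ∃ n < {z | f.SameCycle x z}.ncard, f^[n] x = y := by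
  obtain ⟨n, hn⟩ := h.exists_nat_pow_eq
  rw [f.ncard_sameCycle]
  refine ⟨n % minimalPeriod f x, Nat.mod_lt _ (minimalPeriod_pos_of_mem_periodicPts
    (f.injective.mem_periodicPts x)), ?_⟩
  rw [iterate_mod_minimalPeriod_eq, ← hn, Equiv.Perm.coe_pow]

/-! ### Rotation systems -/

instance SimpleGraph.Dart.instFinite {V : Type*} [Finite V] (G : SimpleGraph V) : Finite G.Dart :=
  Finite.of_injective _ SimpleGraph.Dart.toProd_injective

namespace RotationSystem

variable {V : Type*} {G : SimpleGraph V} (R : RotationSystem G)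

theorem faceNext_apply (d : G.Dart) : R.faceNext d = R.rot d.symm := rfl

theorem faceNext_fst (d : G.Dart) : (R.faceNext d).fst = d.snd := R.rot_fst d.symm

theorem faceOf_eq_iff {d e : G.Dart} : R.faceOf d = R.faceOf e ↔ R.faceNext.SameCycle d e :=
  Quotient.eq (r := Equiv.Perm.SameCycle.setoid R.faceNext)

theorem faceOf_faceNext (d : G.Dart) : R.faceOf (R.faceNext d) = R.faceOf d := by
  rw [faceOf_eq_iff]
  exact ⟨-1, by simp⟩

/-- If the dart `q` follows `p` in the rotation, then the face to the left of `q` enters their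
common vertex along the reverse of `p`. -/
theorem faceOf_of_rot_eq {p q : G.Dart} (h : R.rot p = q) : R.faceOf q = R.faceOf p.symm := by
  rw [← R.faceOf_faceNext p.symm, faceNext_apply, SimpleGraph.Dart.symm_symm, h]

theorem sameCycle_rot_iff {d e : G.Dart} : R.rot.SameCycle d e ↔ d.fst = e.fst := by
  refine ⟨?_, R.sameCycle d e⟩
  rintro ⟨n, rfl⟩
  induction n with
  | zero => simp
  | succ n ih => rw [add_comm, zpow_add, zpow_one, Equiv.Perm.mul_apply, R.rot_fst, ih]
  | pred n ih =>
    rw [ih, sub_eq_add_neg, add_comm, zpow_add, Equiv.Perm.mul_apply, zpow_neg_one]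
    have h := R.rot_fst (R.rot⁻¹ ((R.rot ^ (-n : ℤ)) d))
    rwa [← Equiv.Perm.mul_apply, mul_inv_cancel, Equiv.Perm.one_apply] at h

theorem iterate_faceLength (d : G.Dart) [Finite V] :
    R.faceNext^[R.faceLength (R.faceOf d)] d = d := by
  have : R.faceLength (R.faceOf d) = {e | R.faceNext.SameCycle d e}.ncard := by
    rw [faceLength, ← Nat.card_coe_set_eq]
    simp only [R.faceOf_eq_iff]
    exact Nat.card_congr (Equiv.subtypeEquivRight fun e => Equiv.Perm.sameCycle_comm)
  rw [this, Equiv.Perm.ncard_sameCycle, Function.iterate_minimalPeriod]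

/-- The orbits of the rotation are as large as the degrees of the vertices. -/
theorem ncard_sameCycle_rot (d : G.Dart) :
    {e | R.rot.SameCycle d e}.ncard = (G.neighborSet d.fst).ncard := by
  refine Set.ncard_congr (fun e _ => e.snd) ?_ ?_ ?_
  · intro e he
    have := R.sameCycle_rot_iff.1 he
    rw [this]
    exact e.adj
  · intro e f he hf h
    ext
    · exact (R.sameCycle_rot_iff.1 he).symm.trans (R.sameCycle_rot_iff.1 hf)
    · exact h
  · intro w hw
    exact ⟨⟨(d.fst, w), hw⟩, R.sameCycle_rot_iff.2 rfl, rfl⟩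

theorem exists_lt_iterate_rot [Finite V] {p q : G.Dart} (h : p.fst = q.fst) :
    ∃ n < (G.neighborSet p.fst).ncard, R.rot^[n] p = q := by
  rw [← R.ncard_sameCycle_rot]
  exact (R.sameCycle _ _ h).exists_lt_iterate_eq

theorem iterate_rot_ncard [Finite V] (d : G.Dart) :
    R.rot^[(G.neighborSet d.fst).ncard] d = d := by
  rw [← R.ncard_sameCycle_rot, Equiv.Perm.ncard_sameCycle, Function.iterate_minimalPeriod]

theorem rot_ne [Finite V] {d : G.Dart} (h : 2 ≤ (G.neighborSet d.fst).ncard) : R.rot d ≠ d := by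
  intro hd
  rw [← R.ncard_sameCycle_rot, Equiv.Perm.ncard_sameCycle,
    Function.minimalPeriod_eq_one_iff_isFixedPt.2 hd] at h
  omega

theorem rot_eq_of_ncard_eq_two [Finite V] {p q : G.Dart} (h : p.fst = q.fst) (hpq : p ≠ q)
    (h2 : (G.neighborSet p.fst).ncard = 2) : R.rot p = q := by
  obtain ⟨n, hn, rfl⟩ := R.exists_lt_iterate_rot h
  rw [h2] at hn
  interval_cases n
  · exact absurd rfl hpq
  · rfl

/-- Two of the three darts at a vertex of degree 3 are consecutive in the rotation, in one of the
two orders. -/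
theorem rot_cases_of_ncard_eq_three [Finite V] {p q : G.Dart} (h : p.fst = q.fst) (hpq : p ≠ q)
    (h3 : (G.neighborSet p.fst).ncard = 3) :
    (R.rot p = q ∧ R.rot (R.rot q) = p) ∨ (R.rot q = p ∧ R.rot (R.rot p) = q) := by
  obtain ⟨n, hn, rfl⟩ := R.exists_lt_iterate_rot h
  have hp := R.iterate_rot_ncard p
  rw [h3] at hn hp
  interval_cases n
  · exact absurd rfl hpq
  · exact Or.inl ⟨rfl, hp⟩
  · exact Or.inr ⟨hp, rfl⟩

theorem rot_rot_ne [Finite V] {d : G.Dart} (h : (G.neighborSet d.fst).ncard = 3) :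
    R.rot (R.rot d) ≠ d := by
  intro hd
  have hp := R.iterate_rot_ncard d
  rw [h] at hp
  have : R.rot d = d := by
    change R.rot (R.rot (R.rot d)) = d at hp
    rwa [hd] at hp
  exact R.rot_ne (by omega) this

theorem sum_faceLength [Fintype R.Face] [Finite V] :
    ∑ f, R.faceLength f = Nat.card G.Dart := by
  classical
  have : Fintype V := Fintype.ofFinite V
  have := Nat.card_congr (Equiv.sigmaFiberEquiv R.faceOf)
  rw [← this, Nat.card_sigma]
  rfl

end RotationSystem

namespace SimpleGraph

theorem natCard_dart {V : Type*} [Finite V] (G : SimpleGraph V) :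
    Nat.card G.Dart = 2 * Nat.card G.edgeSet := by
  classical
  have : Fintype V := Fintype.ofFinite V
  rw [Nat.card_eq_fintype_card, G.dart_card_eq_twice_card_edges, Nat.card_eq_fintype_card,
    edgeFinset_card]

theorem sum_ncard_neighborSet {V : Type*} [Fintype V] (G : SimpleGraph V) :
    ∑ v, (G.neighborSet v).ncard = 2 * Nat.card G.edgeSet := by
  classical
  rw [Nat.card_eq_fintype_card, ← edgeFinset_card, ← G.sum_degrees_eq_twice_card_edges]
  refine Finset.sum_congr rfl fun v _ => ?_
  rw [← card_neighborSet_eq_degree, Set.ncard_eq_toFinset_card', Set.toFinset_card]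

/-! ### Cyclic indexing of cycles -/

namespace Walk

variable {V : Type*} {G : SimpleGraph V} {w : V} (W : G.Walk w w)

theorem cycVert_natCast {n : ℕ} (hn : n ≤ W.length) : W.cycVert n = W.getVert n := by
  unfold cycVert
  rcases hn.lt_or_eq with h | rfl
  · rw [Int.emod_eq_of_lt (by positivity) (by exact_mod_cast h)]
    simp
  · simp

theorem cycVert_eq_of_emod_eq {i j : ℤ} (h : i % W.length = j % W.length) :
    W.cycVert i = W.cycVert j := by
  unfold cycVert
  rw [h]

theorem exists_cycVert_eq_getVert (h : 0 < W.length) (i : ℤ) :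
    ∃ n < W.length, W.cycVert i = W.getVert n ∧ W.cycVert (i + 1) = W.getVert (n + 1) := by
  have h0 := Int.emod_nonneg i (b := W.length) (by omega)
  have h1 := Int.emod_lt_of_pos i (b := W.length) (by omega)
  obtain ⟨n, hn⟩ := Int.eq_ofNat_of_zero_le h0
  refine ⟨n, by omega, ?_, ?_⟩
  · rw [← W.cycVert_natCast (by omega)]
    exact W.cycVert_eq_of_emod_eq (by rw [hn, Int.emod_eq_of_lt] <;> omega)
  · rw [← W.cycVert_natCast (by omega)]
    exact W.cycVert_eq_of_emod_eq (by rw [Int.add_emod, hn]; simp)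

theorem adj_cycVert (h : 0 < W.length) (i : ℤ) : G.Adj (W.cycVert i) (W.cycVert (i + 1)) := by
  obtain ⟨n, hn, h1, h2⟩ := W.exists_cycVert_eq_getVert h i
  rw [h1, h2]
  exact W.adj_getVert_succ hn

/-- The dart from `W_i` to `W_{i+1}`. -/
def cycDart (h : 0 < W.length) (i : ℤ) : G.Dart := ⟨(W.cycVert i, W.cycVert (i + 1)),
  W.adj_cycVert h i⟩

variable {W}

theorem IsCycle.length_pos (hW : W.IsCycle) : 0 < W.length := by
  have := hW.three_le_length
  omega

theorem IsCycle.cycVert_eq_iff (hW : W.IsCycle) {i j : ℤ} :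
    W.cycVert i = W.cycVert j ↔ i % W.length = j % W.length := by
  refine ⟨fun h => ?_, W.cycVert_eq_of_emod_eq⟩
  have hL := hW.length_pos
  have h0 := Int.emod_nonneg i (b := W.length) (by omega)
  have h1 := Int.emod_lt_of_pos i (b := W.length) (by omega)
  have h2 := Int.emod_nonneg j (b := W.length) (by omega)
  have h3 := Int.emod_lt_of_pos j (b := W.length) (by omega)
  have := hW.getVert_injOn' (by simp only [Set.mem_ofPred_eq]; omega)
    (by simp only [Set.mem_ofPred_eq]; omega) h
  omega

theorem IsCycle.cycVert_sub_one_ne (hW : W.IsCycle) (i : ℤ) :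
    W.cycVert (i - 1) ≠ W.cycVert (i + 1) := by
  rw [Ne, hW.cycVert_eq_iff, Int.emod_eq_emod_iff_emod_sub_eq_zero]
  have := hW.three_le_length
  intro h
  have := Int.le_of_dvd (by norm_num) ((Int.dvd_neg).2 (Int.dvd_of_emod_eq_zero h))
  omega

theorem mem_edges_iff_exists_cycVert (h : 0 < W.length) {e : Sym2 V} :
    e ∈ W.edges ↔ ∃ i : ℤ, e = s(W.cycVert i, W.cycVert (i + 1)) := by
  induction e with | _ x y =>
  rw [mk_mem_edges_iff_exists]
  constructor
  · rintro ⟨n, hn, h⟩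
    refine ⟨n, ?_⟩
    rw [show (n : ℤ) + 1 = ((n + 1 : ℕ) : ℤ) by simp, cycVert_natCast _ (by omega),
      cycVert_natCast _ (by omega)]
    exact h.symm
  · rintro ⟨i, hi⟩
    obtain ⟨n, hn, h1, h2⟩ := W.exists_cycVert_eq_getVert h i
    exact ⟨n, hn, by rw [hi, h1, h2]⟩

end Walk

end SimpleGraph

/-! ### The edge colouring of the brickwall -/

/-- The displacement from `b_{i,j}`, `i` odd, to its neighbour of index `c`. -/
def brickVec : Fin 3 → ℤ × ℤ := ![(1, 1), (1, 0), (-1, 0)]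

theorem brickNbr_of_odd {v : ℤ × ℤ} (hv : Odd v.1) (c : Fin 3) :
    brickNbr v c = v + brickVec c := by
  fin_cases c <;> simp [brickNbr, hv, brickVec, Prod.ext_iff, sub_eq_add_neg]

theorem brickNbr_of_not_odd {v : ℤ × ℤ} (hv : ¬ Odd v.1) (c : Fin 3) :
    brickNbr v c = v - brickVec c := by
  fin_cases c <;> simp [brickNbr, hv, brickVec, Prod.ext_iff]

theorem odd_fst_brickNbr_iff (v : ℤ × ℤ) (c : Fin 3) : Odd (brickNbr v c).1 ↔ ¬ Odd v.1 := by
  obtain ⟨i, j⟩ := v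
  by_cases hi : Odd i <;> fin_cases c <;> simp [brickNbr, hi] <;> grind

/-- The index of an edge among the neighbours of a vertex is the same at both of its ends: the
indices form a proper 3-edge-colouring of the brickwall. -/
theorem brickNbr_brickNbr (v : ℤ × ℤ) (c : Fin 3) : brickNbr (brickNbr v c) c = v := by
  by_cases hv : Odd v.1
  · rw [brickNbr_of_not_odd (by simpa [odd_fst_brickNbr_iff] using hv), brickNbr_of_odd hv,
      add_sub_cancel_right]
  · rw [brickNbr_of_odd (by simpa [odd_fst_brickNbr_iff] using hv), brickNbr_of_not_odd hv,
      sub_add_cancel]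

/-- The colours along a closed walk of length 6 that does not turn back are `a, b, c, a, b, c`; here
the closedness is expressed by displacements, which have alternating signs along the walk. -/
theorem brickVec_hexagon (a b c d e f : Fin 3) (h1 : a ≠ b) (h2 : b ≠ c) (h3 : c ≠ d)
    (h4 : d ≠ e) (h5 : e ≠ f) (h6 : f ≠ a)
    (h : brickVec a - brickVec b + (brickVec c - brickVec d) + (brickVec e - brickVec f) = 0) :
    c - b = b - a := by
  revert a b c d e f
  decide

/-- A closed walk of length 6 that does not turn back runs around a face of the brickwall: it makes
the same turn twice in a row. -/
theorem brickNbr_hexagon (v : ℤ × ℤ) (a b c d e f : Fin 3) (h1 : a ≠ b) (h2 : b ≠ c) (h3 : c ≠ d)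
    (h4 : d ≠ e) (h5 : e ≠ f) (h6 : f ≠ a)
    (h : brickNbr (brickNbr (brickNbr (brickNbr (brickNbr (brickNbr v a) b) c) d) e) f = v) :
    c - b = b - a := by
  apply brickVec_hexagon a b c d e f h1 h2 h3 h4 h5 h6
  -- Two steps along the walk move by a difference of displacements, with a sign given by parity.
  have two : (∀ x a b, (Odd x.1 ↔ Odd v.1) →
        brickNbr (brickNbr x a) b = x + (brickVec a - brickVec b)) ∨
      (∀ x a b, (Odd x.1 ↔ Odd v.1) →
        brickNbr (brickNbr x a) b = x - (brickVec a - brickVec b)) := by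
    by_cases hv : Odd v.1
    · left
      intro x a b hx
      have hx := hx.2 hv
      rw [brickNbr_of_not_odd (by simpa [odd_fst_brickNbr_iff] using hx), brickNbr_of_odd hx,
        add_sub_assoc]
    · right
      intro x a b hx
      have hx := mt hx.1 hv
      rw [brickNbr_of_odd (by simpa [odd_fst_brickNbr_iff] using hx), brickNbr_of_not_odd hx,
        sub_add]
  have hp : ∀ x a b, Odd (brickNbr (brickNbr x a) b).1 ↔ Odd x.1 := by
    simp [odd_fst_brickNbr_iff]
  rcases two with two | two
  · rw [two _ e f (by simp only [hp]), two _ c d (by simp only [hp]), two _ a b Iff.rfl,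
      add_assoc, add_assoc, add_eq_left] at h
    rw [← h, add_assoc]
  · rw [two _ e f (by simp only [hp]), two _ c d (by simp only [hp]), two _ a b Iff.rfl,
      sub_sub, sub_sub, sub_eq_self] at h
    rw [← h, add_assoc]

/-! ### Boundary cycles of hexagonal patches -/

namespace HexPatch

variable {H : HexPatch.{u}}

/-- A dart is outer if the outer face lies to the left of it. -/
def IsOuter (H : HexPatch.{u}) (d : H.graph.Dart) : Prop := H.emb.faceOf d = H.outer

theorem isOuter_faceNext {d : H.graph.Dart} : H.IsOuter (H.emb.faceNext d) ↔ H.IsOuter d := by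
  rw [IsOuter, H.emb.faceOf_faceNext, IsOuter]

theorem isOuter_of_rot_eq {p q : H.graph.Dart} (h : H.emb.rot p = q) :
    H.IsOuter q ↔ H.IsOuter p.symm := by
  rw [IsOuter, H.emb.faceOf_of_rot_eq h, IsOuter]

theorem deg_eq_two_or_three (H : HexPatch.{u}) (v : H.V) : H.deg v = 2 ∨ H.deg v = 3 := by
  by_cases hv : H.IsBoundaryVertex v
  · exact H.deg_boundary v hv
  · exact Or.inr (H.deg_interior v hv)

theorem rot_ne (d : H.graph.Dart) : H.emb.rot d ≠ d := by
  have := H.finite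
  apply H.emb.rot_ne
  have h := H.deg_eq_two_or_three d.fst
  unfold PlaneGraph.deg at h
  omega

theorem isBoundaryEdge_edge {d : H.graph.Dart} :
    H.IsBoundaryEdge d.edge ↔ H.IsOuter d ∨ H.IsOuter d.symm := by
  constructor
  · rintro ⟨e, he, hed⟩
    rcases (SimpleGraph.dart_edge_eq_iff _ _).1 hed with rfl | rfl
    · exact Or.inl he
    · exact Or.inr he
  · rintro (h | h)
    · exact ⟨d, h, rfl⟩
    · exact ⟨d.symm, h, d.edge_symm⟩

variable {b : H.V} {B : H.graph.Walk b b}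

theorem exists_cycVert_of_isOuter (hB : H.IsBoundaryCycle B) {d : H.graph.Dart}
    (hd : H.IsOuter d ∨ H.IsOuter d.symm) :
    ∃ i, d = B.cycDart hB.1.length_pos i ∨ d = (B.cycDart hB.1.length_pos i).symm := by
  obtain ⟨i, hi⟩ := (SimpleGraph.Walk.mem_edges_iff_exists_cycVert hB.1.length_pos).1
    ((hB.2 d.edge).2 (isBoundaryEdge_edge.2 hd))
  exact ⟨i, (SimpleGraph.dart_edge_eq_iff d (B.cycDart hB.1.length_pos i)).1 hi⟩

theorem isOuter_cycDart (hB : H.IsBoundaryCycle B) (i : ℤ) :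
    H.IsOuter (B.cycDart hB.1.length_pos i) ∨ H.IsOuter (B.cycDart hB.1.length_pos i).symm :=
  isBoundaryEdge_edge.1 ((hB.2 _).1
    ((SimpleGraph.Walk.mem_edges_iff_exists_cycVert hB.1.length_pos).2 ⟨i, rfl⟩))

/-- The dart from `B_i` back to `B_{i-1}`. -/
def prevDart (hB : H.IsBoundaryCycle B) (i : ℤ) : H.graph.Dart :=
  ⟨(B.cycVert i, B.cycVert (i - 1)), by
    have := (B.adj_cycVert hB.1.length_pos (i - 1)).symm
    rwa [sub_add_cancel] at this⟩

theorem prevDart_symm (hB : H.IsBoundaryCycle B) (i : ℤ) :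
    (prevDart hB i).symm = B.cycDart hB.1.length_pos (i - 1) := by
  ext <;> simp [SimpleGraph.Walk.cycDart, prevDart]

theorem eq_prevDart_or_eq_cycDart (hB : H.IsBoundaryCycle B) {i : ℤ} {d : H.graph.Dart}
    (hd : d.fst = B.cycVert i) (ho : H.IsOuter d ∨ H.IsOuter d.symm) :
    d = prevDart hB i ∨ d = B.cycDart hB.1.length_pos i := by
  obtain ⟨j, rfl | rfl⟩ := exists_cycVert_of_isOuter hB ho
  · right
    have h : B.cycVert j = B.cycVert i := hd
    have h' := hB.1.cycVert_eq_iff.1 h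
    ext
    · exact h
    · exact B.cycVert_eq_of_emod_eq (Int.ModEq.add_right 1 h')
  · left
    have h : B.cycVert (j + 1) = B.cycVert i := hd
    have h' := hB.1.cycVert_eq_iff.1 h
    ext
    · exact h
    · refine B.cycVert_eq_of_emod_eq ?_
      have := Int.ModEq.sub_right 1 h'
      rwa [add_sub_cancel_right] at this

/-- The rotation at a vertex of a boundary cycle: the two boundary darts `p` and `q` follow each
other; if there is a third dart `r`, it borders no outer face, which decides whether `p` precedes
`q` or conversely. -/
theorem boundary_rotation (hB : H.IsBoundaryCycle B) (i : ℤ) {p q : H.graph.Dart}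
    (hp : p = prevDart hB i) (hq : q = B.cycDart hB.1.length_pos i) :
    (H.deg (B.cycVert i) = 2 ∧ H.emb.rot p = q ∧ H.emb.rot q = p) ∨
    (H.deg (B.cycVert i) = 3 ∧ H.emb.rot p = q ∧ H.emb.rot q ≠ p ∧
      H.IsOuter q ∧ H.IsOuter p.symm ∧ ¬ H.IsOuter p ∧ ¬ H.IsOuter q.symm) ∨
    (H.deg (B.cycVert i) = 3 ∧ H.emb.rot q = p ∧ H.emb.rot p ≠ q ∧
      H.IsOuter p ∧ H.IsOuter q.symm ∧ ¬ H.IsOuter q ∧ ¬ H.IsOuter p.symm) := by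
  have := H.finite
  have hpf : p.fst = B.cycVert i := by rw [hp]; rfl
  have hqf : q.fst = B.cycVert i := by rw [hq]; rfl
  have hpq : p ≠ q := by
    intro h
    have : p.snd = q.snd := by rw [h]
    rw [hp, hq] at this
    exact hB.1.cycVert_sub_one_ne i this
  have hpo : H.IsOuter p ∨ H.IsOuter p.symm := by
    have := isOuter_cycDart hB (i - 1)
    rwa [← prevDart_symm hB, SimpleGraph.Dart.symm_symm, ← hp, or_comm] at this
  have hqo : H.IsOuter q ∨ H.IsOuter q.symm := hq ▸ isOuter_cycDart hB i
  have third : ∀ {r}, r.fst = B.cycVert i → r ≠ p → r ≠ q → ¬ H.IsOuter r ∧ ¬ H.IsOuter r.symm := by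
    intro r hr h1 h2
    rw [← not_or]
    intro h
    rcases eq_prevDart_or_eq_cycDart hB hr h with h | h
    · exact h1 (h.trans hp.symm)
    · exact h2 (h.trans hq.symm)
  rcases H.deg_eq_two_or_three (B.cycVert i) with h2 | h3
  · left
    exact ⟨h2, H.emb.rot_eq_of_ncard_eq_two (hpf.trans hqf.symm) hpq (by rw [hpf]; exact h2),
      H.emb.rot_eq_of_ncard_eq_two (hqf.trans hpf.symm) hpq.symm (by rw [hqf]; exact h2)⟩
  · right
    have key : ∀ {p q : H.graph.Dart}, p.fst = B.cycVert i → q.fst = B.cycVert i →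
        (∀ {r}, r.fst = B.cycVert i → r ≠ p → r ≠ q → ¬ H.IsOuter r ∧ ¬ H.IsOuter r.symm) →
        H.IsOuter p ∨ H.IsOuter p.symm → H.IsOuter q ∨ H.IsOuter q.symm →
        H.emb.rot p = q → H.emb.rot (H.emb.rot q) = p →
        H.emb.rot q ≠ p ∧
          H.IsOuter q ∧ H.IsOuter p.symm ∧ ¬ H.IsOuter p ∧ ¬ H.IsOuter q.symm := by
      intro p q hpf hqf third hpo hqo h1 h2
      have hqp : H.emb.rot q ≠ p := by
        rw [← h1]
        exact H.emb.rot_rot_ne (by rw [hpf]; exact h3)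
      obtain ⟨hr, hr'⟩ := third ((H.emb.rot_fst q).trans hqf) hqp (rot_ne q)
      have hpn : ¬ H.IsOuter p := by rwa [isOuter_of_rot_eq h2]
      have hqn : ¬ H.IsOuter q.symm := by rwa [← isOuter_of_rot_eq rfl]
      exact ⟨hqp, hqo.resolve_right hqn, hpo.resolve_left hpn, hpn, hqn⟩
    rcases H.emb.rot_cases_of_ncard_eq_three (hpf.trans hqf.symm) hpq
      (by rw [hpf]; exact h3) with ⟨h1, h2⟩ | ⟨h1, h2⟩
    · exact Or.inl ⟨h3, h1, key hpf hqf third hpo hqo h1 h2⟩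
    · exact Or.inr ⟨h3, h1, key hqf hpf (fun h h' h'' => third h h'' h') hqo hpo h1 h2⟩

/-- The outer face passes straight through the vertices of a boundary cycle, in both directions. -/
theorem isOuter_cycDart_iff (hB : H.IsBoundaryCycle B) (i : ℤ) :
    (H.IsOuter (B.cycDart hB.1.length_pos i) ↔ H.IsOuter (prevDart hB i).symm) ∧
    (H.IsOuter (B.cycDart hB.1.length_pos i).symm ↔ H.IsOuter (prevDart hB i)) := by
  rcases boundary_rotation hB i rfl rfl with ⟨-, h1, h2⟩ | h | h
  · exact ⟨isOuter_of_rot_eq h1, (isOuter_of_rot_eq h2).symm⟩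
  · tauto
  · tauto

/-- A boundary cycle has the outer face on the same side all along. -/
theorem isOuter_cycDart_iff_zero (hB : H.IsBoundaryCycle B) (i : ℤ) :
    (H.IsOuter (B.cycDart hB.1.length_pos i) ↔ H.IsOuter (B.cycDart hB.1.length_pos 0)) ∧
    (H.IsOuter (B.cycDart hB.1.length_pos i).symm ↔
      H.IsOuter (B.cycDart hB.1.length_pos 0).symm) := by
  have step : ∀ i, (H.IsOuter (B.cycDart hB.1.length_pos i) ↔
        H.IsOuter (B.cycDart hB.1.length_pos (i - 1))) ∧
      (H.IsOuter (B.cycDart hB.1.length_pos i).symm ↔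
        H.IsOuter (B.cycDart hB.1.length_pos (i - 1)).symm) := by
    intro i
    have := isOuter_cycDart_iff hB i
    rwa [← prevDart_symm hB, SimpleGraph.Dart.symm_symm]
  induction i with
  | zero => simp
  | succ n ih =>
    have := step (n + 1)
    rw [add_sub_cancel_right] at this
    exact ⟨this.1.trans ih.1, this.2.trans ih.2⟩
  | pred n ih =>
    have := step (-n)
    exact ⟨this.1.symm.trans ih.1, this.2.symm.trans ih.2⟩

/-- If some edge has the outer face on both sides then so has every edge: all vertices of the
boundary cycle have degree 2, and the boundary cycle is the whole graph. -/
theorem isOuter_of_isOuter_symm (hB : H.IsBoundaryCycle B) {d : H.graph.Dart}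
    (hd : H.IsOuter d) (hd' : H.IsOuter d.symm) :
    (∀ v, H.deg v = 2) ∧ ∀ e, H.IsOuter e := by
  have h0 : H.IsOuter (B.cycDart hB.1.length_pos 0) ∧
      H.IsOuter (B.cycDart hB.1.length_pos 0).symm := by
    obtain ⟨i, rfl | rfl⟩ := exists_cycVert_of_isOuter hB (Or.inl hd)
    · exact ⟨(isOuter_cycDart_iff_zero hB i).1.1 hd, (isOuter_cycDart_iff_zero hB i).2.1 hd'⟩
    · exact ⟨(isOuter_cycDart_iff_zero hB i).1.1 hd', (isOuter_cycDart_iff_zero hB i).2.1 hd⟩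
  have hall : ∀ i, H.IsOuter (B.cycDart hB.1.length_pos i) ∧
      H.IsOuter (B.cycDart hB.1.length_pos i).symm := fun i =>
    ⟨(isOuter_cycDart_iff_zero hB i).1.2 h0.1, (isOuter_cycDart_iff_zero hB i).2.2 h0.2⟩
  have hdeg : ∀ i, H.deg (B.cycVert i) = 2 ∧
      H.emb.rot (prevDart hB i) = B.cycDart hB.1.length_pos i := by
    intro i
    rcases boundary_rotation hB i rfl rfl with h | h | h
    · exact ⟨h.1, h.2.1⟩
    · exact absurd (hall i).2 h.2.2.2.2.2.2
    · exact absurd (hall i).1 h.2.2.2.2.2.1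
  have := H.finite
  have hdart : ∀ {i} {e : H.graph.Dart}, e.fst = B.cycVert i →
      e = prevDart hB i ∨ e = B.cycDart hB.1.length_pos i := by
    intro i e he
    by_contra! hc
    have := H.emb.rot_eq_of_ncard_eq_two (p := prevDart hB i) (q := e) he.symm hc.1.symm
      (hdeg i).1
    rw [(hdeg i).2] at this
    exact hc.2 this.symm
  have hon : ∀ v, ∃ i, v = B.cycVert i := by
    intro v
    have := H.connected.preconnected (B.cycVert 0) v
    rw [SimpleGraph.reachable_iff_reflTransGen] at this
    induction this with
    | refl => exact ⟨0, rfl⟩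
    | @tail x y _ hxy ih =>
      obtain ⟨i, rfl⟩ := ih
      rcases hdart (e := ⟨(_, y), hxy⟩) rfl with h | h
      · exact ⟨i - 1, congrArg (·.snd) h⟩
      · exact ⟨i + 1, congrArg (·.snd) h⟩
  refine ⟨fun v => ?_, fun e => ?_⟩
  · obtain ⟨i, rfl⟩ := hon v
    exact (hdeg i).1
  · obtain ⟨i, hi⟩ := hon e.fst
    rcases hdart hi with rfl | rfl
    · rw [← (isOuter_cycDart_iff hB i).2]
      exact (hall i).2
    · exact (hall i).1

/-- No edge has the outer face on both sides. -/
theorem not_isOuter_symm (hB : H.IsBoundaryCycle B) {d : H.graph.Dart} (hd : H.IsOuter d) :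
    ¬ H.IsOuter d.symm := by
  intro hd'
  obtain ⟨hdeg, hout⟩ := isOuter_of_isOuter_symm hB hd hd'
  have := H.finite
  have := Fintype.ofFinite H.V
  -- All degrees are 2 and there is a single face, so the Euler characteristic is 1.
  have hE := H.graph.sum_ncard_neighborSet
  have hface : Nat.card H.emb.Face = 1 := by
    rw [Nat.card_eq_one_iff_unique]
    refine ⟨⟨?_⟩, ⟨H.outer⟩⟩
    have : ∀ f, f = H.outer := by
      intro f
      induction f using Quotient.inductionOn with | _ e => exact hout e
    intro f g
    rw [this f, this g]
  have hχ := H.spherical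
  have hdeg' : ∀ v, (H.graph.neighborSet v).ncard = 2 := hdeg
  simp only [hdeg', Finset.sum_const, Finset.card_univ, smul_eq_mul] at hE
  rw [RotationSystem.IsSpherical, RotationSystem.eulerChar, hface, Nat.card_eq_fintype_card] at hχ
  omega

/-- Each edge of the boundary cycle carries exactly one outer dart. -/
theorem faceLength_outer (hB : H.IsBoundaryCycle B) : H.emb.faceLength H.outer = B.length := by
  classical
  have h : B.edges.toFinset.card = B.length := by
    rw [List.toFinset_card_of_nodup hB.1.isCircuit.isTrail.edges_nodup,
      SimpleGraph.Walk.length_edges]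
  rw [← h, ← Set.ncard_coe_finset]
  refine Set.ncard_congr (s := {d | H.emb.faceOf d = H.outer}) (fun d _ => d.edge) ?_ ?_ ?_
  · intro d hd
    simpa [hB.2] using ⟨d, hd, rfl⟩
  · intro d e hd he hde
    rcases (SimpleGraph.dart_edge_eq_iff _ _).1 hde with h | rfl
    · exact h
    · exact absurd hd (not_isOuter_symm hB he)
  · intro e he
    simp only [List.coe_toFinset, Set.mem_ofPred_eq, hB.2] at he
    obtain ⟨d, hd, rfl⟩ := he
    exact ⟨d, hd, rfl⟩

theorem exists_cycVert_of_deg_eq_two (hB : H.IsBoundaryCycle B) {v : H.V} (hv : H.deg v = 2) :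
    ∃ n < B.length, v = B.cycVert (n : ℕ) := by
  have hb : H.IsBoundaryVertex v := by
    by_contra h
    have := H.deg_interior v h
    omega
  obtain ⟨d, hd, rfl⟩ := hb
  have aux : ∀ i : ℤ, ∃ n < B.length, B.cycVert i = B.cycVert (n : ℕ) := by
    intro i
    obtain ⟨n, hn, h, -⟩ := B.exists_cycVert_eq_getVert hB.1.length_pos i
    exact ⟨n, hn, h.trans (B.cycVert_natCast hn.le).symm⟩
  obtain ⟨i, rfl | rfl⟩ := exists_cycVert_of_isOuter hB (Or.inl hd)
  · exact aux i
  · exact aux (i + 1)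

open Classical in
theorem card_deg_eq_two [Fintype H.V] (hB : H.IsBoundaryCycle B) :
    (Finset.univ.filter fun v => H.deg v = 2).card =
      ((Finset.range B.length).filter fun n => H.deg (B.cycVert (n : ℕ)) = 2).card := by
  symm
  refine Finset.card_bij (fun n _ => B.cycVert (n : ℕ)) ?_ ?_ ?_
  · intro n hn
    simpa using (Finset.mem_filter.1 hn).2
  · intro m hm n hn h
    have h1 := Finset.mem_range.1 (Finset.mem_filter.1 hm).1
    have h2 := Finset.mem_range.1 (Finset.mem_filter.1 hn).1
    rw [hB.1.cycVert_eq_iff, Int.emod_eq_of_lt, Int.emod_eq_of_lt] at h <;> omega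
  · intro v hv
    have hv := (Finset.mem_filter.1 hv).2
    obtain ⟨n, hn, rfl⟩ := exists_cycVert_of_deg_eq_two hB hv
    exact ⟨n, by simp [hn, hv], rfl⟩

open Classical in
/-- By Euler's formula, the boundary of a hexagonal patch has six more vertices of degree 2 than
of degree 3. -/
theorem card_deg_two_eq_card_deg_three_add_six (hB : H.IsBoundaryCycle B) :
    ((Finset.range B.length).filter fun n => H.deg (B.cycVert (n : ℕ)) = 2).card =
      ((Finset.range B.length).filter fun n => H.deg (B.cycVert (n : ℕ)) = 3).card + 6 := by
  have := H.finite
  have := Fintype.ofFinite H.V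
  have : Finite H.emb.Face := Quotient.finite _
  have := Fintype.ofFinite H.emb.Face
  have hχ := H.spherical
  have hE := H.graph.sum_ncard_neighborSet
  have hF := H.emb.sum_faceLength
  rw [H.graph.natCard_dart, ← Finset.add_sum_erase _ _ (Finset.mem_univ H.outer),
    faceLength_outer hB, Finset.sum_congr rfl (fun f hf => H.inner_length f
      (Finset.ne_of_mem_erase hf)), Finset.sum_const, Finset.card_erase_of_mem (Finset.mem_univ _),
    Finset.card_univ, smul_eq_mul] at hF
  -- Each vertex of degree 2 lacks one edge for the degree sum to be `3 |V|`.
  have hn : (Finset.univ.filter fun v => H.deg v = 2).card +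
      ∑ v, (H.graph.neighborSet v).ncard = 3 * Fintype.card H.V := by
    rw [Finset.card_filter, ← Finset.sum_add_distrib, ← Finset.card_univ, mul_comm,
      ← smul_eq_mul, ← Finset.sum_const]
    refine Finset.sum_congr rfl fun v _ => ?_
    change _ + H.deg v = 3
    rcases H.deg_eq_two_or_three v with h | h <;> simp [h]
  have hL := Finset.card_filter_add_card_filter_not (s := Finset.range B.length)
    (fun n : ℕ => H.deg (B.cycVert n) = 2)
  have h3 : ∀ n : ℕ, ¬ H.deg (B.cycVert n) = 2 ↔ H.deg (B.cycVert n) = 3 := by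
    intro n
    have := H.deg_eq_two_or_three (B.cycVert n)
    omega
  simp only [h3, Finset.card_range] at hL
  rw [card_deg_eq_two hB] at hn
  have hF0 : 0 < Fintype.card H.emb.Face := Fintype.card_pos_iff.2 ⟨H.outer⟩
  rw [RotationSystem.IsSpherical, RotationSystem.eulerChar, Nat.card_eq_fintype_card,
    Nat.card_eq_fintype_card (α := H.emb.Face)] at hχ
  omega

end HexPatch

/-! ### Turns of the image of a facial walk -/

namespace HexPatch

variable {H : HexPatch.{u}}

/-- The index of the image of a dart `d` among the neighbours of the image of its initial vertex. -/
noncomputable def dartColor (φ : H.graph →g brickwall) (d : H.graph.Dart) : Fin 3 :=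
  ((brickwall_adj_iff _ _).1 (φ.map_adj d.adj)).choose

variable {φ : H.graph →g brickwall}

theorem map_snd (φ : H.graph →g brickwall) (d : H.graph.Dart) :
    φ d.snd = brickNbr (φ d.fst) (dartColor φ d) :=
  ((brickwall_adj_iff _ _).1 (φ.map_adj d.adj)).choose_spec

/-- Both ends of an edge see the same index, as `brickNbr` is an edge colouring. -/
theorem dartColor_symm (φ : H.graph →g brickwall) (d : H.graph.Dart) :
    dartColor φ d.symm = dartColor φ d := by
  apply brickNbr_injective (φ d.snd)
  have h := map_snd φ d
  have h' := map_snd φ d.symm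
  simp only [SimpleGraph.Dart.symm_toProd, Prod.fst_swap, Prod.snd_swap] at h'
  rw [← h', h, brickNbr_brickNbr]

theorem eq_of_dartColor_eq (hφ : ∀ v, Set.InjOn φ (H.graph.neighborSet v)) {d e : H.graph.Dart}
    (h : d.fst = e.fst) (hc : dartColor φ d = dartColor φ e) : d = e := by
  ext
  · exact h
  · refine hφ d.fst d.adj (by rw [h]; exact e.adj) ?_
    rw [map_snd, map_snd, h, hc]

/-- The turn that the image of a facial walk makes at the end of a dart `d`. -/
noncomputable def faceTurn (φ : H.graph →g brickwall) (d : H.graph.Dart) : Fin 3 :=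
  dartColor φ (H.emb.faceNext d) - dartColor φ d

theorem faceTurn_eq_of_rot_eq {p q : H.graph.Dart} (h : H.emb.rot p = q) :
    faceTurn φ p.symm = dartColor φ q - dartColor φ p := by
  rw [faceTurn, H.emb.faceNext_apply, SimpleGraph.Dart.symm_symm, h, dartColor_symm]

theorem dartColor_ne_faceNext (hφ : ∀ v, Set.InjOn φ (H.graph.neighborSet v))
    (d : H.graph.Dart) : dartColor φ d ≠ dartColor φ (H.emb.faceNext d) := by
  intro h
  rw [← dartColor_symm φ d] at h
  exact rot_ne d.symm (eq_of_dartColor_eq hφ (H.emb.rot_fst d.symm).symm h).symm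

theorem faceTurn_ne_zero (hφ : ∀ v, Set.InjOn φ (H.graph.neighborSet v)) (d : H.graph.Dart) :
    faceTurn φ d ≠ 0 :=
  sub_ne_zero.2 (dartColor_ne_faceNext hφ d).symm

/-- Inner faces are mapped to faces of the brickwall, so that all turns along them are the same. -/
theorem faceTurn_faceNext (hφ : ∀ v, Set.InjOn φ (H.graph.neighborSet v)) {d : H.graph.Dart}
    (hd : ¬ H.IsOuter d) : faceTurn φ (H.emb.faceNext d) = faceTurn φ d := by
  have := H.finite
  have h6 := H.emb.iterate_faceLength d
  rw [H.inner_length _ hd] at h6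
  have hs : ∀ e, φ (H.emb.faceNext e).fst = brickNbr (φ e.fst) (dartColor φ e) := by
    intro e
    rw [H.emb.faceNext_fst, map_snd]
  have hne := dartColor_ne_faceNext hφ
  refine brickNbr_hexagon (φ d.fst) _ _ _ _ _ _ (hne d) (hne _) (hne _) (hne _) (hne _) ?_ ?_
  · have := hne (H.emb.faceNext^[5] d)
    rw [← Function.iterate_succ_apply' H.emb.faceNext, h6] at this
    exact this
  · simp only [← hs]
    exact congrArg (fun e : H.graph.Dart => φ e.fst) h6

/-- Turns at a common vertex of two inner faces agree. -/
theorem faceTurn_eq_of_snd_eq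
    (hφ : ∀ v, Set.InjOn φ (H.graph.neighborSet v)) {d e : H.graph.Dart} (hde : d.snd = e.snd)
    (hd : ¬ H.IsOuter d) (he : ¬ H.IsOuter e) : faceTurn φ d = faceTurn φ e := by
  have := H.finite
  by_cases heq : d = e
  · rw [heq]
  have hne : d.symm ≠ e.symm := fun h => heq (SimpleGraph.Dart.symm_involutive.injective h)
  have hf : d.symm.fst = e.symm.fst := hde
  rcases H.deg_eq_two_or_three d.symm.fst with h2 | h3
  · -- At a vertex of degree 2 one of the two faces is the outer one.
    exfalso
    have h1 := H.emb.rot_eq_of_ncard_eq_two hf hne h2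
    have h1' := H.emb.rot_eq_of_ncard_eq_two hf.symm hne.symm (hf ▸ h2)
    have hb : H.IsBoundaryVertex d.symm.fst := by
      by_contra h
      have := H.deg_interior _ h
      omega
    obtain ⟨a, ha, hav⟩ := hb
    rcases eq_or_ne d.symm a with h | h
    · rw [← h] at ha
      exact he ((isOuter_of_rot_eq h1').1 ha)
    · have := H.emb.rot_eq_of_ncard_eq_two hav.symm h h2
      rw [h1] at this
      rw [← this] at ha
      exact hd ((isOuter_of_rot_eq h1).1 ha)
  · -- The three indices at a vertex of degree 3 are distinct, so consecutive differences agree.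
    have key : ∀ {p q : H.graph.Dart}, p.fst = d.symm.fst → p ≠ q → H.emb.rot p = q →
        H.emb.rot (H.emb.rot q) = p → faceTurn φ p.symm = faceTurn φ q.symm := by
      intro p q hp hpq h1 h2
      have hq : q.fst = p.fst := by rw [← h1, H.emb.rot_fst]
      have hr : (H.emb.rot q).fst = p.fst := by rw [H.emb.rot_fst, hq]
      rw [faceTurn_eq_of_rot_eq h1, faceTurn_eq_of_rot_eq (p := q) rfl]
      have c1 : dartColor φ q ≠ dartColor φ p :=
        fun h => hpq (eq_of_dartColor_eq hφ hq h).symm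
      have c2 : dartColor φ (H.emb.rot q) ≠ dartColor φ q :=
        fun h => rot_ne q (eq_of_dartColor_eq hφ (hr.trans hq.symm) h)
      have c3 : dartColor φ (H.emb.rot q) ≠ dartColor φ p := by
        intro h
        have h := eq_of_dartColor_eq hφ hr h
        rw [← h1] at h
        exact H.emb.rot_rot_ne (by rw [hp]; exact h3) h
      generalize dartColor φ (H.emb.rot q) = x at *
      generalize dartColor φ q = y at *
      generalize dartColor φ p = z at *
      clear * - c1 c2 c3
      revert x y z
      decide
    rcases H.emb.rot_cases_of_ncard_eq_three hf hne h3 with ⟨h1, h2⟩ | ⟨h1, h2⟩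
    · exact key rfl hne h1 h2
    · exact (key hf.symm hne.symm h1 h2).symm

/-- All turns along all inner faces are the same: the map preserves or reverses orientation
globally. -/
theorem exists_faceTurn_eq {b : H.V} {B : H.graph.Walk b b} (hB : H.IsBoundaryCycle B)
    (hφ : ∀ v, Set.InjOn φ (H.graph.neighborSet v)) :
    ∃ σ ≠ 0, ∀ d, ¬ H.IsOuter d → faceTurn φ d = σ := by
  obtain ⟨d₀, hd₀⟩ : ∃ d, ¬ H.IsOuter d := by
    let d := B.cycDart hB.1.length_pos 0
    by_cases h : H.IsOuter d
    · exact ⟨_, not_isOuter_symm hB h⟩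
    · exact ⟨_, h⟩
  -- The face that leaves a vertex along `d` also enters it, along the preceding dart `e`.
  have back : ∀ {d}, ¬ H.IsOuter d → ∃ e, ¬ H.IsOuter e ∧ e.snd = d.fst ∧
      faceTurn φ e = faceTurn φ d := by
    intro d hd
    obtain ⟨e, rfl⟩ := H.emb.faceNext.surjective d
    rw [isOuter_faceNext] at hd
    exact ⟨e, hd, (H.emb.faceNext_fst e).symm, (faceTurn_faceNext hφ hd).symm⟩
  have main : ∀ v, ∃ d, ¬ H.IsOuter d ∧ d.snd = v ∧ faceTurn φ d = faceTurn φ d₀ := by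
    intro v
    have := H.connected.preconnected d₀.snd v
    rw [SimpleGraph.reachable_iff_reflTransGen] at this
    induction this with
    | refl => exact ⟨d₀, hd₀, rfl, rfl⟩
    | @tail x y _ hxy ih =>
      obtain ⟨d, hd, rfl, hdt⟩ := ih
      let e : H.graph.Dart := ⟨(d.snd, y), hxy⟩
      by_cases he : H.IsOuter e
      · have he' := not_isOuter_symm hB he
        obtain ⟨a, ha, hay, hat⟩ := back he'
        have h : faceTurn φ e.symm = faceTurn φ d := faceTurn_eq_of_snd_eq hφ rfl he' hd
        exact ⟨a, ha, hay, by rw [hat, h, hdt]⟩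
      · obtain ⟨a, ha, hay, hat⟩ := back he
        exact ⟨e, he, rfl, by rw [← hat, faceTurn_eq_of_snd_eq hφ hay ha hd, hdt]⟩
  refine ⟨_, faceTurn_ne_zero hφ d₀, fun d hd => ?_⟩
  obtain ⟨e, he, hed, het⟩ := main d.snd
  rw [← het, faceTurn_eq_of_snd_eq hφ hed.symm hd he]

/-- Let `p` and `q` be two darts at a vertex such that the face to the right of `q` is an inner one.
If `p` follows `q` in the rotation, then the index changes from `q` to `p` by the common turn `σ`
of the inner faces. Otherwise the dart following `q` takes the index `dartColor φ q + σ`, and `p` is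
left with the third one. -/
theorem dartColor_of_rotation (hφ : ∀ v, Set.InjOn φ (H.graph.neighborSet v)) {σ : Fin 3}
    (hσ0 : σ ≠ 0) (hσ : ∀ d, ¬ H.IsOuter d → faceTurn φ d = σ) {p q : H.graph.Dart}
    (hpq : p.fst = q.fst) (hne : p ≠ q) (hq : ¬ H.IsOuter q.symm) :
    (H.emb.rot q = p → dartColor φ p = dartColor φ q + σ) ∧
    (H.emb.rot q ≠ p → dartColor φ p = dartColor φ q - σ) := by
  have h := faceTurn_eq_of_rot_eq (φ := φ) (p := q) rfl
  rw [hσ _ hq] at h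
  constructor
  · rintro rfl
    rw [h]
    abel
  · intro hr
    have c1 : dartColor φ (H.emb.rot q) ≠ dartColor φ p := fun h =>
      hr (eq_of_dartColor_eq hφ ((H.emb.rot_fst q).trans hpq.symm) h)
    have c2 : dartColor φ p ≠ dartColor φ q := fun h => hne (eq_of_dartColor_eq hφ hpq h)
    generalize dartColor φ (H.emb.rot q) = x at *
    generalize dartColor φ q = y at *
    generalize dartColor φ p = z at *
    clear * - c1 c2 h hσ0
    revert x y z σ
    decide

/-- Along a boundary cycle, the degree of a vertex decides the turn of the image of the cycle, in
the same way at all vertices. -/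
theorem exists_boundary_turn {b : H.V} {B : H.graph.Walk b b} (hB : H.IsBoundaryCycle B)
    (hφ : ∀ v, Set.InjOn φ (H.graph.neighborSet v)) :
    ∃ ε : Fin 3, ε ≠ 0 ∧ ∀ i, ∃ c, φ (B.cycVert (i + 1)) = brickNbr (φ (B.cycVert i)) c ∧
      ∃ c', φ (B.cycVert (i - 1)) = brickNbr (φ (B.cycVert i)) c' ∧
      (H.deg (B.cycVert i) = 2 → c' = c + ε) ∧ (H.deg (B.cycVert i) = 3 → c' = c - ε) := by
  obtain ⟨σ, hσ0, hσ⟩ := exists_faceTurn_eq hB hφ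
  by_cases h0 : H.IsOuter (B.cycDart hB.1.length_pos 0)
  · refine ⟨σ, hσ0, fun i => ⟨_, map_snd φ (B.cycDart hB.1.length_pos i), _,
      map_snd φ (prevDart hB i), ?_⟩⟩
    have hq := (isOuter_cycDart_iff_zero hB i).1.2 h0
    have hq' := not_isOuter_symm hB hq
    have key := dartColor_of_rotation hφ hσ0 hσ (p := prevDart hB i)
      (q := B.cycDart hB.1.length_pos i) rfl (fun h => hB.1.cycVert_sub_one_ne i (congrArg (·.snd) h)) hq'
    rcases boundary_rotation hB i rfl rfl with ⟨h, -, h1⟩ | ⟨h, -, h1, -⟩ | h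
    · exact ⟨fun _ => key.1 h1, by omega⟩
    · exact ⟨by omega, fun _ => key.2 h1⟩
    · exact absurd hq h.2.2.2.2.2.1
  · -- The roles of the two boundary darts are interchanged, which reverses the sign.
    refine ⟨-σ, neg_ne_zero.2 hσ0, fun i => ⟨_, map_snd φ (B.cycDart hB.1.length_pos i), _,
      map_snd φ (prevDart hB i), ?_⟩⟩
    have hq := mt (isOuter_cycDart_iff_zero hB i).1.1 h0
    have hp := mt (isOuter_cycDart_iff hB i).1.2 hq
    have key := dartColor_of_rotation hφ hσ0 hσ (p := B.cycDart hB.1.length_pos i)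
      (q := prevDart hB i) rfl (fun h => hB.1.cycVert_sub_one_ne i (congrArg (·.snd) h).symm) hp
    rcases boundary_rotation hB i rfl rfl with ⟨h, h1, -⟩ | h | ⟨h, -, h1, -⟩
    · refine ⟨fun _ => ?_, by omega⟩
      rw [key.1 h1]
      abel
    · exact absurd h.2.2.2.1 hq
    · refine ⟨by omega, fun _ => ?_⟩
      rw [key.2 h1]
      abel

end HexPatch

/-! ### Turning numbers of solutions -/

theorem rightTurn_iff {w : ℤ × ℤ} {W : brickwall.Walk w w} {i : ℤ} {c c' : Fin 3}
    (h : W.cycVert (i + 1) = brickNbr (W.cycVert i) c)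
    (h' : W.cycVert (i - 1) = brickNbr (W.cycVert i) c') : RightTurn W i ↔ c' = c + 1 := by
  unfold RightTurn
  simp [h, h', (brickNbr_injective _).eq_iff]

theorem leftTurn_iff {w : ℤ × ℤ} {W : brickwall.Walk w w} {i : ℤ} {c c' : Fin 3}
    (h : W.cycVert (i + 1) = brickNbr (W.cycVert i) c)
    (h' : W.cycVert (i - 1) = brickNbr (W.cycVert i) c') : LeftTurn W i ↔ c' = c - 1 := by
  unfold LeftTurn
  simp [h, h', (brickNbr_injective _).eq_iff]

/-- In a solution, the degrees of the boundary vertices determine the turns, in one of the two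
ways. -/
theorem Solution.degree_iff_turn {w : ℤ × ℤ} {W : brickwall.Walk w w} (S : Solution.{u} W) :
    (∀ i, (RightTurn W i ↔ S.H.deg (S.B.cycVert i) = 2) ∧
      (LeftTurn W i ↔ S.H.deg (S.B.cycVert i) = 3)) ∨
    (∀ i, (RightTurn W i ↔ S.H.deg (S.B.cycVert i) = 3) ∧
      (LeftTurn W i ↔ S.H.deg (S.B.cycVert i) = 2)) := by
  obtain ⟨ε, hε, h⟩ := HexPatch.exists_boundary_turn S.isBoundaryCycle S.locallyInjective
  have hdeg := fun i => S.H.deg_eq_two_or_three (S.B.cycVert i)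
  simp only [S.map_eq] at h
  have h12 : ε = 1 ∨ ε = -1 := by
    clear h
    revert ε
    decide
  have ne : ∀ c : Fin 3, c + 1 ≠ c - 1 := by decide
  rcases h12 with rfl | rfl
  · left
    intro i
    obtain ⟨c, h1, c', h2, h3, h4⟩ := h i
    rw [rightTurn_iff h1 h2, leftTurn_iff h1 h2]
    rcases hdeg i with hd | hd
    · simp [hd, h3 hd, ne]
    · simp [hd, h4 hd, (ne _).symm]
  · right
    intro i
    obtain ⟨c, h1, c', h2, h3, h4⟩ := h i
    rw [rightTurn_iff h1 h2, leftTurn_iff h1 h2]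
    rcases hdeg i with hd | hd
    · simp [hd, h3 hd, ← sub_eq_add_neg, (ne _).symm]
    · simp [hd, h4 hd, ne]

open Classical in
/-- The index in the definitions of `rightCount` and `leftCount` is an integer, so the range of
natural numbers is coerced there, monadically, to a finite set of integers. This leaves
cardinalities unchanged. -/
theorem Finset.card_filter_bind_pure_natCast (s : Finset ℕ) (p : ℤ → Prop) :
    (Finset.filter p (do let a ← s; pure (a : ℤ))).card = (s.filter fun n : ℕ => p n).card := by
  have : (do let a ← s; pure (a : ℤ)) = s.map Nat.castEmbedding := by
    ext x
    simp
  rw [this, Finset.filter_map, Finset.card_map]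
  rfl

open Classical in
theorem turningNumber_eq_card_sub_card {w : ℤ × ℤ} (W : brickwall.Walk w w) :
    turningNumber W = ((((Finset.range W.length).filter fun n : ℕ => RightTurn W n).card : ℚ) -
      ((Finset.range W.length).filter fun n : ℕ => LeftTurn W n).card) / 6 := by
  rw [turningNumber, rightCount, leftCount, Finset.card_filter_bind_pure_natCast,
    Finset.card_filter_bind_pure_natCast]

theorem Solution.turningNumber_eq {w : ℤ × ℤ} {W : brickwall.Walk w w} (S : Solution.{u} W) :
    (S.IsClockwise ∧ turningNumber W = 1) ∨ (S.IsAnticlockwise ∧ turningNumber W = -1) := by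
  have hcount := HexPatch.card_deg_two_eq_card_deg_three_add_six S.isBoundaryCycle
  rw [S.length_eq] at hcount
  rcases S.degree_iff_turn with h | h
  · refine Or.inl ⟨fun i => ⟨(h i).1.1, (h i).2.1⟩, ?_⟩
    simp only [turningNumber_eq_card_sub_card, h, hcount]
    push_cast
    ring
  · refine Or.inr ⟨fun i => ⟨(h i).1.1, (h i).2.1⟩, ?_⟩
    simp only [turningNumber_eq_card_sub_card, h, hcount]
    push_cast
    ring

theorem mainTheorem5 {w : ℤ × ℤ} (W : brickwall.Walk w w) (hW : W.NoTurnBack) :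
    (turningNumber W = 1 → ∀ S : Solution.{u} W, S.IsClockwise) ∧
    (turningNumber W = -1 → ∀ S : Solution.{u} W, S.IsAnticlockwise) ∧
    (turningNumber W ≠ 1 ∧ turningNumber W ≠ -1 → IsEmpty (Solution.{u} W)) := by
  refine ⟨fun ht S => ?_, fun ht S => ?_, fun ⟨h1, h2⟩ => ⟨fun S => ?_⟩⟩
  · rcases S.turningNumber_eq with h | h
    · exact h.1
    · norm_num [h.2] at ht
  · rcases S.turningNumber_eq with h | h
    · norm_num [h.2] at ht
    · exact h.1
  · rcases S.turningNumber_eq with h | h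
    · exact h1 h.2
    · exact h2 h.2
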